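/- Let $K$ be a field of characteristic $0$ (for instance $\mathbb{Q}$, $\mathbb{R}$ or $\mathbb{C}$). Let $\Lambda=\bigoplus_{n\ge 0}\Lambda^n$ be the ring of symmetric functions over $K$ in $x=(x_1,x_2,\ldots)$, i.e. the formal power series of bounded degree that are invariant under all permutations of the variables, where $\Lambda^n$ is the subspace of the homogeneous ones of degree $n$. Let $d$ be a positive integer or $d=\infty$. The truncated homogeneous symmetric functions are defined by $$\sum_{n\ge 0}h^{[d]}_n t^n=\prod_{k\ge 1}\bigl(1+x_kt+x_k^2t^2+\cdots+x_k^dt^d\bigr),\qquad h^{[d]}_\lambda=\prod_i h^{[d]}_{\lambda_i},$$ that is, $h^{[d]}_n$ is the sum of all monomials of degree $n$ in which every exponent is at most $d$ (no restriction if $d=\infty$). Let $m_\lambda$ be the monomial symmetric functions and $p_\lambda=\prod_i p_{\lambda_i}$, $p_k=\sum_i x_i^k$, the power sum symmetric functions. For a partition $\mu=(1^{n_1},2^{n_2},\ldots)$ put $$z_\mu=\prod_{i\ge 1}i^{n_i}\,n_i!,\qquad \varepsilon_\mu=(-1)^{|\mu|-\ell(\mu)},\qquad D^{[d]}_\mu=(-d)^{\sum_{k\ge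 1}n_{k(d+1)}},$$ where for $d=\infty$ the exponent is $0$. For $n\ge 0$ let $R=(R_{\lambda\mu})_{\lambda,\mu\vdash n}$ be the (unique) matrix with $p_\lambda=\sum_{\mu\vdash n}R_{\lambda\mu}m_\mu$ for all $\lambda\vdash n$. Then: 1. For every $n\ge 0$ and every $\lambda\vdash n$, $$h^{[d]}_\lambda=\sum_{\mu\vdash n}z_\mu^{-1}D^{[d]}_\mu R_{\mu\lambda}\,p_\mu .$$ 2. Equivalently, the matrix $R'z^{-1}D^{[d]}$ is the transition matrix $M(h^{[d]},p)$ from $(h^{[d]}_\lambda)_{\lambda\vdash n}$ to $(p_\mu)_{\mu\vdash n}$, that is, it is the only matrix $A$ with $h^{[d]}_\lambda=\sum_{\mu\vdash n}A_{\lambda\mu}p_\mu$ for all $\lambda\vdash n$. Here $R'$ is the transpose of $R$, and $z^{-1}$ and $D^{[d]}$ are the diagonal matrices with diagonal entries $z_\mu^{-1}$ and $D^{[d]}_\mu$. 3. $D^{[1]}_\mu=\varepsilon_\mu$ and $D^{[\infty]}_\mu=1$ for every partition $\mu$. 4. For every $n\ge 0$, $\{h^{[d]}_\lambda:\lambda\vdash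 n\}$ is a basis of $\Lambda^n$; hence the $h^{[d]}_\lambda$, with $\lambda$ ranging over all partitions, form a basis of $\Lambda$. -/

import Mathlib

open scoped Matrix

namespace SymmFun

noncomputable section

open MvPowerSeries

/-- The ring `Λ` of symmetric functions over `K` in the variables `x₀, x₁, x₂, …`: the formal power
series of bounded degree that are invariant under every permutation of the variables. -/
def Lambda (K : Type*) [Field K] : Subalgebra K (MvPowerSeries ℕ K) where
  carrier := {f | (∀ e : Equiv.Perm ℕ, rename e f = f) ∧
    ∃ N : ℕ, ∀ a : ℕ →₀ ℕ, coeff a f ≠ 0 → a.degree ≤ N}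
  mul_mem' := by
    rintro f g ⟨hf, N, hN⟩ ⟨hg, M, hM⟩
    refine ⟨fun e => by rw [map_mul, hf, hg], N + M, fun a ha => ?_⟩
    classical
    rw [coeff_mul] at ha
    obtain ⟨⟨b, c⟩, hbc, hne⟩ := Finset.exists_ne_zero_of_sum_ne_zero ha
    have hbc' : b + c = a := by simpa using hbc
    rw [← hbc', map_add]
    exact add_le_add (hN b (left_ne_zero_of_mul hne)) (hM c (right_ne_zero_of_mul hne))
  add_mem' := by
    rintro f g ⟨hf, N, hN⟩ ⟨hg, M, hM⟩
    refine ⟨fun e => by rw [map_add, hf, hg], max N M, fun a ha => ?_⟩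
    by_cases h : coeff a f = 0
    · exact le_max_of_le_right (hM a fun h' => ha (by rw [map_add, h, h', add_zero]))
    · exact le_max_of_le_left (hN a h)
  algebraMap_mem' r := by
    classical
    refine ⟨fun e => (rename e).commutes r, 0, fun a ha => ?_⟩
    rw [MvPowerSeries.algebraMap_apply, coeff_C] at ha
    have h0 : a = 0 := by
      by_contra h
      exact ha (if_neg h)
    simp [h0]

/-- The subspace `Λⁿ` of homogeneous symmetric functions of degree `n`. -/
def LambdaDeg (K : Type*) [Field K] (n : ℕ) : Submodule K (MvPowerSeries ℕ K) where
  carrier := {f | f ∈ Lambda K ∧ ∀ a : ℕ →₀ ℕ, coeff a f ≠ 0 → a.degree = n}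
  add_mem' := by
    rintro f g ⟨hf, hf'⟩ ⟨hg, hg'⟩
    refine ⟨add_mem hf hg, fun a ha => ?_⟩
    by_cases h : coeff a f = 0
    · exact hg' a fun h' => ha (by rw [map_add, h, h', add_zero])
    · exact hf' a h
  zero_mem' := ⟨zero_mem _, fun a ha => absurd (map_zero _) ha⟩
  smul_mem' := by
    rintro c f ⟨hf, hf'⟩
    refine ⟨Subalgebra.smul_mem _ hf c, fun a ha => hf' a fun h => ha ?_⟩
    rw [coeff_smul, h, mul_zero]

open Classical in
/-- The monomial symmetric function `m_μ`: the sum of all distinct monomials `x^a` whose nonzero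
exponents are, in some order, the parts of `μ`. -/
def msf (K : Type*) [Field K] {n : ℕ} (μ : n.Partition) : MvPowerSeries ℕ K :=
  fun a : ℕ →₀ ℕ => if a.support.val.map a = μ.parts then 1 else 0

open Classical in
/-- The power sum `p_k = ∑_i x_i ^ k` (for `k ≥ 1`). -/
def psf (K : Type*) [Field K] (k : ℕ) : MvPowerSeries ℕ K :=
  fun a : ℕ →₀ ℕ => if ∃ i : ℕ, a = Finsupp.single i k then 1 else 0

/-- The power sum symmetric function `p_μ = ∏_i p_{μ_i}`. -/
def psfPart (K : Type*) [Field K] {n : ℕ} (μ : n.Partition) : MvPowerSeries ℕ K :=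
  (μ.parts.map (psf K)).prod

open Classical in
/-- The truncated homogeneous symmetric function `h_k^{[d]}`, i.e. the coefficient of `t ^ k` in
`∏_i (1 + x_i t + ⋯ + x_i ^ d t ^ d)`: the sum of all monomials of degree `k` with every exponent
at most `d`. For `d = ⊤` there is no restriction on the exponents. -/
def thsf (K : Type*) [Field K] (d : ℕ∞) (k : ℕ) : MvPowerSeries ℕ K :=
  fun a : ℕ →₀ ℕ => if (∀ i, (a i : ℕ∞) ≤ d) ∧ a.degree = k then 1 else 0

/-- `h_μ^{[d]} = ∏_i h_{μ_i}^{[d]}`. -/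
def thsfPart (K : Type*) [Field K] (d : ℕ∞) {n : ℕ} (μ : n.Partition) : MvPowerSeries ℕ K :=
  (μ.parts.map (thsf K d)).prod

/-- `z_μ = ∏_{i ≥ 1} i ^ {n_i} n_i !` for `μ = (1^{n_1}, 2^{n_2}, …)`. -/
def zNum {n : ℕ} (μ : n.Partition) : ℕ :=
  ∏ i ∈ Finset.Icc 1 n, i ^ μ.parts.count i * (μ.parts.count i).factorial

/-- The sign `ε_μ = (-1) ^ (|μ| - ℓ(μ))`. -/
def epsSign (K : Type*) [Field K] {n : ℕ} (μ : n.Partition) : K :=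
  (-1) ^ (n - μ.parts.card)

/-- `∑_{k ≥ 1} n_{k (d + 1)}` for `μ = (1^{n_1}, 2^{n_2}, …)`, where `n_∞ = 0`. -/
def multExp (d : ℕ∞) {n : ℕ} (μ : n.Partition) : ℕ :=
  ∑ k ∈ Finset.Icc 1 n, (μ.parts.filter fun i : ℕ => (i : ℕ∞) = (k : ℕ∞) * (d + 1)).card

/-- `D_μ^{[d]} = (-d) ^ (∑_k n_{k (d + 1)})`. For `d = ⊤` the exponent vanishes, so the base (which
is then `0`) is irrelevant. -/
def dCoef (K : Type*) [Field K] (d : ℕ∞) {n : ℕ} (μ : n.Partition) : K :=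
  (-(d.toNat : K)) ^ multExp d μ

/-- `A` is a transition matrix from the family `u` to the family `v`:
`u_μ = ∑_ν A_{μν} v_ν` for every `μ`. -/
def IsTransitionMatrix {K ι V : Type*} [Field K] [Fintype ι] [AddCommGroup V] [Module K V]
    (u v : ι → V) (A : Matrix ι ι K) : Prop :=
  ∀ μ, u μ = ∑ ν, A μ ν • v ν

/-- The family `u` is a basis of the subspace `W`. -/
def IsBasisOf {K ι V : Type*} [Field K] [AddCommGroup V] [Module K V]
    (u : ι → V) (W : Submodule K V) : Prop :=
  LinearIndependent K u ∧ Submodule.span K (Set.range u) = W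

end

end SymmFun

open SymmFun

/-!
The argument rests on the generating function `exp (∑_{k ≥ 1} c_k t ^ k / k)`, whose coefficients
are `e_n(c) = ∑_{μ ⊢ n} z_μ⁻¹ c_μ` with `c_μ = ∏_i c_{μ_i}` (`cycleSum`). It is handled through the
differential equation that it satisfies: removing one part from `μ` gives the recursion
`natCast_smul_cycleSum_succ`, so sums of sequences `c` turn into products of generating functions,
and the substitution of `c_k y ^ k` for `c_k` multiplies `e_n` by `y ^ n`. Hence, with
`c_k p_k(y)` for `c_k`, the sum `∑_{μ ⊢ n} z_μ⁻¹ c_μ p_μ(y)` is the degree `n` part of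
`∏_i ∑_m e_m(c) y_i ^ m`, and its coefficient at `y ^ a` is `∏_i e_{a_i}(c)` (`sum_coeff_psfPart`).
No infinite product is needed, as only the finitely many variables in `y ^ a` matter.

Let `D_k = -d` if `d + 1` divides `k` and `D_k = 1` otherwise, in particular always if `d = ∞`. In
one variable `e_n(D)` is `1` for `n ≤ d` and `0` for `n > d` (`cycleSum_truncWeight`), because `D`
sums to zero over `d + 1` consecutive integers. The coefficient formula is now used twice. With
`c = D` it says that `h_n^{[d]} = e_n(D_k p_k)` (`thsf_eq_cycleSum`). With `c_k = D_k p_k(x)`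
and `a` an exponent with parts `λ` it then says that `h_λ^{[d]} = ∑_μ z_μ⁻¹ D_μ R_{μλ} p_μ`, since
`R_{μλ}` is the coefficient of `x^λ` in `p_μ` (`thsfPart_eq_sum`).

For the bases, `Λⁿ` is spanned by the `m_μ` because symmetric functions have equal coefficients at
exponents that differ by a permutation. The `p_μ` are linearly independent: `x^λ` occurs in `p_μ`
only if `λ` arises by merging parts of `μ`, so `R` is triangular with respect to the number of
parts, with nonzero diagonal. Thus the `p_μ` form a basis of `Λⁿ` and `R` is invertible; as `D_μ`
and `z_μ` are nonzero, the matrix from the `h_λ^{[d]}` to the `p_μ` is invertible too.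
-/

namespace SymmFun

noncomputable section

/-! ### The cycle index generating function -/

/-- The sum `∑_{μ ⊢ n} z_μ⁻¹ c_μ`, where `c_μ = ∏_i c_{μ_i}`, for a sequence `c` of elements of a
commutative `K`-algebra. It is the coefficient of `t ^ n` in `exp (∑_{k ≥ 1} c_k t ^ k / k)`. -/
def cycleSum (K : Type*) {B : Type*} [Field K] [CommRing B] [Algebra K B] (c : ℕ → B) (n : ℕ) : B :=
  ∑ μ : n.Partition, (zNum μ : K)⁻¹ • (μ.parts.map c).prod

/-- The generating function `∑_n (∑_{μ ⊢ n} z_μ⁻¹ c_μ) t ^ n = exp (∑_{k ≥ 1} c_k t ^ k / k)`. -/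
def cycleSeries (K : Type*) {B : Type*} [Field K] [CommRing B] [Algebra K B] (c : ℕ → B) :
    PowerSeries B :=
  PowerSeries.mk (cycleSum K c)

lemma zNum_eq_prod_of_subset {n : ℕ} (μ : n.Partition) {T : Finset ℕ}
    (hT : μ.parts.toFinset ⊆ T) :
    zNum μ = ∏ i ∈ T, i ^ μ.parts.count i * (μ.parts.count i).factorial := by
  have key : ∀ U : Finset ℕ, μ.parts.toFinset ⊆ U →
      ∏ i ∈ μ.parts.toFinset, i ^ μ.parts.count i * (μ.parts.count i).factorial =
        ∏ i ∈ U, i ^ μ.parts.count i * (μ.parts.count i).factorial := fun U hU =>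
    Finset.prod_subset hU fun i _ hi => by
      rw [Multiset.mem_toFinset, ← Multiset.count_eq_zero] at hi
      simp [hi]
  rw [zNum, ← key _ hT, key]
  intro i hi
  rw [Multiset.mem_toFinset] at hi
  exact Finset.mem_Icc.2 ⟨μ.parts_pos hi, μ.le_of_mem_parts hi⟩

lemma zNum_ne_zero {n : ℕ} (μ : n.Partition) : zNum μ ≠ 0 :=
  Finset.prod_ne_zero_iff.2 fun i hi =>
    mul_ne_zero (pow_ne_zero _ (by have := (Finset.mem_Icc.1 hi).1; omega))
      (Nat.factorial_ne_zero _)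

/-- Adding a part `k` to `ν` multiplies `z_ν` by `k` times the new multiplicity of `k`. -/
lemma zNum_cons {n m k : ℕ} (μ : n.Partition) (ν : m.Partition) (h : μ.parts = k ::ₘ ν.parts) :
    zNum μ = k * μ.parts.count k * zNum ν := by
  have hk : k ∈ μ.parts.toFinset := by simp [h]
  have hν : ν.parts.toFinset ⊆ μ.parts.toFinset := by
    intro i
    simp +contextual [h]
  rw [zNum_eq_prod_of_subset μ subset_rfl, zNum_eq_prod_of_subset ν hν,
    ← Finset.mul_prod_erase _ _ hk, ← Finset.mul_prod_erase _ _ hk]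
  have hrest : ∏ i ∈ μ.parts.toFinset.erase k,
        i ^ μ.parts.count i * (μ.parts.count i).factorial =
      ∏ i ∈ μ.parts.toFinset.erase k, i ^ ν.parts.count i * (ν.parts.count i).factorial :=
    Finset.prod_congr rfl fun i hi => by
      rw [h, Multiset.count_cons_of_ne (Finset.ne_of_mem_erase hi)]
  rw [hrest, h, Multiset.count_cons_self, pow_succ, Nat.factorial_succ]
  ring

section Algebra

variable {K B : Type*} [Field K] [CommRing B] [Algebra K B]

/-- The recursion for `cycleSum`: in `(n + 1) ∑_μ z_μ⁻¹ c_μ`, the factor `n + 1` is the sum of the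
parts of `μ`, and removing a part `k` from `μ` divides `z_μ` by `k` times its multiplicity. -/
lemma natCast_smul_cycleSum_succ [CharZero K] (c : ℕ → B) (n : ℕ) :
    ((n + 1 : ℕ) : K) • cycleSum K c (n + 1) =
      ∑ p ∈ Finset.HasAntidiagonal.antidiagonal n, c (p.1 + 1) * cycleSum K c p.2 := by
  classical
  have hparts : ∀ μ : (n + 1).Partition,
      n + 1 = ∑ k ∈ Finset.range (n + 1), (k + 1) * μ.parts.count (k + 1) := by
    intro μ
    have hsub : μ.parts.toFinset ⊆ (Finset.range (n + 1)).image (· + 1) := by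
      intro i hi
      rw [Multiset.mem_toFinset] at hi
      have h1 := μ.parts_pos hi
      have h2 := μ.le_of_mem_parts hi
      exact Finset.mem_image.2 ⟨i - 1, Finset.mem_range.2 (by omega), by omega⟩
    conv_lhs => rw [← μ.parts_sum, Finset.sum_multiset_count, Finset.sum_subset hsub
      (fun i _ hi => by
        rw [Multiset.mem_toFinset, ← Multiset.count_eq_zero] at hi
        simp [hi])]
    rw [Finset.sum_image (by simp)]
    simp [mul_comm]
  rw [Finset.Nat.sum_antidiagonal_eq_sum_range_succ (fun i j => c (i + 1) * cycleSum K c j)]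
  rw [cycleSum, Finset.smul_sum]
  have hexp : ∀ μ : (n + 1).Partition,
      ((n + 1 : ℕ) : K) • (zNum μ : K)⁻¹ • (μ.parts.map c).prod =
      ∑ k ∈ Finset.range (n + 1),
        (((k + 1) * μ.parts.count (k + 1) : ℕ) : K) • (zNum μ : K)⁻¹ • (μ.parts.map c).prod := by
    intro μ
    rw [← Finset.sum_smul, ← Nat.cast_sum, ← hparts μ]
  rw [Finset.sum_congr rfl fun μ _ => hexp μ, Finset.sum_comm]
  refine Finset.sum_congr rfl fun k hk => ?_
  have hk' : k + 1 ≤ n + 1 := by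
    have := Finset.mem_range.1 hk
    omega
  have hsubtype : ∑ μ : (n + 1).Partition,
        (((k + 1) * μ.parts.count (k + 1) : ℕ) : K) • (zNum μ : K)⁻¹ • (μ.parts.map c).prod =
      ∑ μ : {μ : (n + 1).Partition // k + 1 ∈ μ.parts},
        (((k + 1) * μ.1.parts.count (k + 1) : ℕ) : K) •
          (zNum μ.1 : K)⁻¹ • (μ.1.parts.map c).prod := by
    rw [← Finset.sum_subtype (Finset.univ.filter fun μ : (n + 1).Partition => k + 1 ∈ μ.parts)
      (by simp) fun μ : (n + 1).Partition => (((k + 1) * μ.parts.count (k + 1) : ℕ) : K) •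
          (zNum μ : K)⁻¹ • (μ.parts.map c).prod, Finset.sum_filter_of_ne]
    intro μ _ hne
    by_contra hmem
    exact hne (by simp [Multiset.count_eq_zero.2 hmem])
  rw [hsubtype, ← Nat.add_sub_add_right n 1 k, cycleSum, Finset.mul_sum,
    ← (Nat.Partition.partitionWithPartEquiv (Nat.le_add_left 1 k) hk').sum_comp]
  refine Finset.sum_congr rfl fun μ _ => ?_
  set ν := Nat.Partition.partitionWithPartEquiv (Nat.le_add_left 1 k) hk' μ with hν
  have hμ : μ.1.parts = (k + 1) ::ₘ ν.parts := by
    rw [hν, Nat.Partition.partitionWithPartEquiv_apply_parts, Multiset.cons_erase μ.2]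
  have hcount : (((k + 1) * μ.1.parts.count (k + 1) : ℕ) : K) ≠ 0 :=
    Nat.cast_ne_zero.2 (mul_ne_zero k.succ_ne_zero (Multiset.count_ne_zero.2 μ.2))
  rw [zNum_cons μ.1 ν hμ, Nat.cast_mul (_ * _), mul_inv, smul_smul, mul_inv_cancel_left₀ hcount, hμ,
    Multiset.map_cons, Multiset.prod_cons, mul_smul_comm]

@[simp]
lemma cycleSum_zero (c : ℕ → B) : cycleSum K c 0 = 1 := by
  simp [cycleSum, zNum]

open PowerSeries in
lemma derivative_cycleSeries [CharZero K] (c : ℕ → B) :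
    derivative B (cycleSeries K c) = mk (fun k => c (k + 1)) * cycleSeries K c := by
  ext n
  rw [coeff_derivative, coeff_mul, cycleSeries]
  simp only [coeff_mk]
  rw [← natCast_smul_cycleSum_succ, Algebra.smul_def, map_natCast, mul_comm]
  push_cast
  ring

open PowerSeries in
/-- A first order linear differential equation has at most one power series solution with a given
constant term in characteristic zero. -/
lemma eq_of_derivative_eq_mul (K : Type*) {B : Type*} [Field K] [CharZero K] [CommRing B]
    [Algebra K B] {C F G : PowerSeries B} (hF : derivative B F = C * F)
    (hG : derivative B G = C * G) (h0 : coeff 0 F = coeff 0 G) : F = G := by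
  ext n
  induction n using Nat.strong_induction_on with
  | _ n ih =>
    rcases n with _ | n
    · exact h0
    -- The coefficients of `t ^ n` in both equations involve only coefficients up to the `n`-th.
    have hn : ((n + 1 : ℕ) : K) • coeff (n + 1) F = ((n + 1 : ℕ) : K) • coeff (n + 1) G := by
      have h1 := congrArg (coeff n) hF
      have h2 := congrArg (coeff n) hG
      rw [coeff_derivative, coeff_mul] at h1 h2
      rw [Algebra.smul_def, Algebra.smul_def, map_natCast, mul_comm, Nat.cast_succ, h1, mul_comm,
        h2]
      refine Finset.sum_congr rfl fun p hp => ?_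
      rw [ih p.2 (by have := Finset.HasAntidiagonal.mem_antidiagonal.1 hp; omega)]
    exact (IsUnit.mk0 _ (Nat.cast_ne_zero.2 n.succ_ne_zero)).smul_left_cancel.1 hn

open PowerSeries in
lemma cycleSeries_add [CharZero K] (c c' : ℕ → B) :
    cycleSeries K (c + c') = cycleSeries K c * cycleSeries K c' := by
  refine eq_of_derivative_eq_mul K (derivative_cycleSeries _) ?_ (by simp [cycleSeries])
  have hadd : mk (fun k => (c + c') (k + 1)) =
      (mk fun k => c (k + 1)) + mk fun k => c' (k + 1) := by
    ext
    simp
  rw [Derivation.leibniz, derivative_cycleSeries, derivative_cycleSeries, hadd, smul_eq_mul,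
    smul_eq_mul]
  ring

open PowerSeries in
lemma cycleSeries_zero [CharZero K] : cycleSeries K (0 : ℕ → B) = 1 := by
  refine eq_of_derivative_eq_mul K (C := 0) ?_ (by simp) (by simp [cycleSeries])
  rw [derivative_cycleSeries]
  congr 1

lemma cycleSeries_sum [CharZero K] {ι : Type*} (S : Finset ι) (c : ι → ℕ → B) :
    cycleSeries K (∑ i ∈ S, c i) = ∏ i ∈ S, cycleSeries K (c i) := by
  classical
  induction S using Finset.induction_on with
  | empty => simp [cycleSeries_zero]
  | insert i S hi ih => rw [Finset.sum_insert hi, Finset.prod_insert hi, cycleSeries_add, ih]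

lemma prod_map_pow (y : B) (s : Multiset ℕ) : (s.map fun k => y ^ k).prod = y ^ s.sum := by
  induction s using Multiset.induction_on with
  | empty => simp
  | cons k s ih => simp [ih, pow_add]

lemma cycleSum_mul_pow (c : ℕ → B) (y : B) (n : ℕ) :
    cycleSum K (fun k => c k * y ^ k) n = cycleSum K c n * y ^ n := by
  rw [cycleSum, cycleSum, Finset.sum_mul]
  refine Finset.sum_congr rfl fun μ _ => ?_
  rw [Multiset.prod_map_mul, prod_map_pow, μ.parts_sum, smul_mul_assoc]

lemma map_cycleSum {B' : Type*} [CommRing B'] [Algebra K B'] (φ : B →ₐ[K] B') (c : ℕ → B) (n : ℕ) :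
    φ (cycleSum K c n) = cycleSum K (fun k => φ (c k)) n := by
  simp [cycleSum, map_multiset_prod]

/-- The coefficient of `x ^ a` in `∑_μ z_μ⁻¹ c_μ p_μ(x_i : i ∈ S)` is `∏_{i ∈ S} e_{a_i}`, where
`e_n = ∑_{μ ⊢ n} z_μ⁻¹ c_μ`: the generating function of the left hand side is the product over
`i ∈ S` of the generating functions of `e_n x_i ^ n`. -/
lemma coeff_cycleSum_psum [CharZero K] (S : Finset ℕ) (c : ℕ → B) {n : ℕ} {a : ℕ →₀ ℕ}
    (ha : a.support ⊆ S) (hn : a.degree = n) :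
    MvPolynomial.coeff a
      (cycleSum K (fun k => ∑ i ∈ S, MvPolynomial.C (c k) * MvPolynomial.X i ^ k) n) =
    ∏ i ∈ S, cycleSum K c (a i) := by
  have hseries : cycleSeries K (fun k => ∑ i ∈ S, MvPolynomial.C (c k) * MvPolynomial.X i ^ k) =
      ∏ i ∈ S, cycleSeries K
        (fun k => (MvPolynomial.C (c k) * MvPolynomial.X i ^ k : MvPolynomial ℕ B)) := by
    rw [← cycleSeries_sum]
    congr 1
    ext1
    simp
  have hcoeff := congrArg (PowerSeries.coeff n) hseries
  rw [PowerSeries.coeff_prod, cycleSeries, PowerSeries.coeff_mk] at hcoeff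
  have hprod : ∀ l ∈ Finset.finsuppAntidiag S n, ∏ i ∈ S, PowerSeries.coeff (l i) (cycleSeries K
      (fun k => (MvPolynomial.C (c k) * MvPolynomial.X i ^ k : MvPolynomial ℕ B))) =
      MvPolynomial.monomial l (∏ i ∈ S, cycleSum K c (l i)) := by
    intro l hl
    have hC : ∀ m, cycleSum K (fun k => (MvPolynomial.C (c k) : MvPolynomial ℕ B)) m =
        MvPolynomial.C (cycleSum K c m) := fun m =>
      (map_cycleSum (Algebra.ofId B (MvPolynomial ℕ B) |>.restrictScalars K) c m).symm
    simp only [cycleSeries, PowerSeries.coeff_mk, cycleSum_mul_pow, hC]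
    rw [Finset.prod_mul_distrib, ← map_prod, MvPolynomial.monomial_eq,
      Finsupp.prod_of_support_subset _ (Finset.mem_finsuppAntidiag.1 hl).2 _ (by simp)]
  have ha' : a ∈ Finset.finsuppAntidiag S n := by
    rw [Finset.mem_finsuppAntidiag, ← hn, Finsupp.degree_apply]
    exact ⟨(Finset.sum_subset ha (by simp)).symm, ha⟩
  rw [hcoeff, Finset.sum_congr rfl hprod, MvPolynomial.coeff_sum, Finset.sum_eq_single a]
  · simp
  · intro l _ hl
    rw [MvPolynomial.coeff_monomial, if_neg hl]
  · exact fun h => absurd ha' h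

end Algebra

open MvPowerSeries

section PowerSums

variable {K : Type*} [Field K]

/-! ### Coefficients of power sum products -/

open Classical in
lemma coeff_psf (k : ℕ) (a : ℕ →₀ ℕ) :
    coeff a (psf K k) = if ∃ i, a = Finsupp.single i k then 1 else 0 := rfl

/-- Only the variables occurring in `x ^ a` matter for the coefficient of `x ^ a` in a product of
power sums. -/
lemma coeff_prod_psum {B : Type*} [CommRing B] [Algebra K B] (S : Finset ℕ) (s : Multiset ℕ)
    (hs : ∀ k ∈ s, 0 < k) {a : ℕ →₀ ℕ} (ha : a.support ⊆ S) :
    MvPolynomial.coeff a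
      (s.map fun k => ∑ i ∈ S, (MvPolynomial.X i ^ k : MvPolynomial ℕ B)).prod =
    algebraMap K B (coeff a (s.map (psf K)).prod) := by
  classical
  induction s using Multiset.induction_on generalizing a with
  | empty =>
    simp only [Multiset.map_zero, Multiset.prod_zero, MvPolynomial.coeff_one, coeff_one]
    by_cases h : a = 0 <;> simp [h, eq_comm]
  | cons k s ih =>
    rw [Multiset.map_cons, Multiset.prod_cons, Multiset.map_cons, Multiset.prod_cons,
      MvPolynomial.coeff_mul, coeff_mul, map_sum]
    refine Finset.sum_congr rfl fun p hp => ?_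
    have hpa : p.1 + p.2 = a := Finset.HasAntidiagonal.mem_antidiagonal.1 hp
    have h1 : p.1.support ⊆ S := (Finsupp.support_mono (hpa ▸ le_self_add)).trans ha
    have h2 : p.2.support ⊆ S := (Finsupp.support_mono (hpa ▸ le_add_self)).trans ha
    rw [map_mul, ih (fun i hi => hs i (Multiset.mem_cons_of_mem hi)) h2]
    congr 1
    have hk : 0 < k := hs k (Multiset.mem_cons_self k s)
    simp only [MvPolynomial.coeff_sum, MvPolynomial.coeff_X_pow, coeff_psf]
    split_ifs with h
    · obtain ⟨i, hi⟩ := h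
      have hiS : i ∈ S := h1 (by rw [hi]; simp [hk.ne'])
      rw [Finset.sum_eq_single i, if_pos hi.symm, map_one]
      · intro j _ hj
        rw [if_neg]
        intro h'
        rw [hi, Finsupp.single_left_inj hk.ne'] at h'
        exact hj h'
      · exact fun h' => absurd hiS h'
    · rw [map_zero]
      exact Finset.sum_eq_zero fun i _ => if_neg fun h' => h ⟨i, h'.symm⟩

/-- The expansion of the Cauchy type kernel: the coefficient of `y ^ a` in
`∑_μ z_μ⁻¹ c_μ p_μ(y)` is the product of the `∑_{μ ⊢ a_i} z_μ⁻¹ c_μ`. -/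
lemma sum_coeff_psfPart [CharZero K] {B : Type*} [CommRing B] [Algebra K B] (c : ℕ → B) {n : ℕ}
    {a : ℕ →₀ ℕ} (hn : a.degree = n) :
    ∑ μ : n.Partition, ((zNum μ : K)⁻¹ * coeff a (psfPart K μ)) • (μ.parts.map c).prod =
      ∏ i ∈ a.support, cycleSum K c (a i) := by
  rw [← coeff_cycleSum_psum a.support c subset_rfl hn, cycleSum, MvPolynomial.coeff_sum]
  refine Finset.sum_congr rfl fun μ _ => ?_
  simp only [← Finset.mul_sum]
  have hC : (μ.parts.map fun k => (MvPolynomial.C (c k) : MvPolynomial ℕ B)).prod =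
      MvPolynomial.C (μ.parts.map c).prod := by
    rw [map_multiset_prod, Multiset.map_map]
    rfl
  rw [Multiset.prod_map_mul, MvPolynomial.coeff_smul, hC, MvPolynomial.coeff_C_mul,
    coeff_prod_psum (K := K) _ _ (fun _ h => μ.parts_pos h) subset_rfl, mul_smul, psfPart,
    Algebra.smul_def (coeff _ _), mul_comm]

/-! ### Homogeneity -/

lemma coeff_psf_eq_zero {k : ℕ} {a : ℕ →₀ ℕ} (h : a.degree ≠ k) : coeff a (psf K k) = 0 := by
  refine if_neg ?_
  rintro ⟨i, rfl⟩
  exact h (Finsupp.degree_single i k)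

lemma coeff_prod_psf_eq_zero (s : Multiset ℕ) {a : ℕ →₀ ℕ} (h : a.degree ≠ s.sum) :
    coeff a (s.map (psf K)).prod = 0 := by
  classical
  induction s using Multiset.induction_on generalizing a with
  | empty =>
    rw [Multiset.map_zero, Multiset.prod_zero, coeff_one, if_neg]
    rintro rfl
    simp at h
  | cons k s ih =>
    rw [Multiset.map_cons, Multiset.prod_cons, coeff_mul]
    refine Finset.sum_eq_zero fun p hp => ?_
    have hpa : p.1 + p.2 = a := Finset.HasAntidiagonal.mem_antidiagonal.1 hp
    by_cases h1 : p.1.degree = k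
    · rw [ih, mul_zero]
      rw [← hpa, map_add, h1, Multiset.sum_cons] at h
      exact fun h' => h (by rw [h'])
    · rw [coeff_psf_eq_zero h1, zero_mul]

lemma coeff_psfPart_eq_zero {n : ℕ} (μ : n.Partition) {a : ℕ →₀ ℕ} (h : a.degree ≠ n) :
    coeff a (psfPart K μ) = 0 :=
  coeff_prod_psf_eq_zero _ (by rwa [μ.parts_sum])

/-! ### The truncation weights -/

variable (K) in
/-- The weight `-d` of a part divisible by `d + 1`, and `1` of any other part; there are no parts of
the first kind for `d = ∞`. Then `∑_k D_k t ^ k / k` is the logarithm of `1 + t + ⋯ + t ^ d`. -/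
def truncWeight : ℕ∞ → ℕ → K
  | ⊤, _ => 1
  | (d : ℕ), k => if d + 1 ∣ k then -(d : K) else 1

lemma truncWeight_top (k : ℕ) : truncWeight K ⊤ k = 1 := rfl

lemma truncWeight_coe (d k : ℕ) :
    truncWeight K (d : ℕ∞) k = if d + 1 ∣ k then -(d : K) else 1 := rfl

/-- The weights sum to zero over any `d + 1` consecutive integers. -/
lemma sum_range_truncWeight (d a : ℕ) :
    ∑ j ∈ Finset.range (d + 1), truncWeight K (d : ℕ∞) (a + j) = 0 := by
  induction a with
  | zero =>
    rw [Finset.sum_range_succ', Finset.sum_congr rfl fun j hj => ?_]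
    rotate_left
    · exact fun _ => 1
    · rw [truncWeight_coe, if_neg]
      intro h
      have := Nat.le_of_dvd (by omega) h
      have := Finset.mem_range.1 hj
      omega
    · simp [truncWeight_coe]
  | succ a ih =>
    rw [Finset.sum_range_succ'] at ih
    rw [Finset.sum_range_succ, ← ih]
    have hper : truncWeight K (d : ℕ∞) (a + 1 + d) = truncWeight K (d : ℕ∞) (a + 0) := by
      simp only [truncWeight_coe, add_assoc, add_comm 1 d, Nat.dvd_add_left dvd_rfl, add_zero]
    rw [hper]
    simp only [add_assoc, add_comm 1]

lemma dCoef_eq_prod (d : ℕ∞) {n : ℕ} (μ : n.Partition) :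
    dCoef K d μ = (μ.parts.map (truncWeight K d)).prod := by
  rw [dCoef, multExp]
  have hs : ∀ i ∈ μ.parts, 0 < i ∧ i ≤ n := fun i hi => ⟨μ.parts_pos hi, μ.le_of_mem_parts hi⟩
  generalize μ.parts = s at hs
  induction s using Multiset.induction_on with
  | empty => simp
  | cons i s ih =>
    have hi := hs i (Multiset.mem_cons_self i s)
    specialize ih fun j hj => hs j (Multiset.mem_cons_of_mem hj)
    simp only [Multiset.filter_cons, Multiset.card_add, Finset.sum_add_distrib, pow_add, ih,
      Multiset.map_cons, Multiset.prod_cons]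
    congr 1
    cases d using ENat.recTopCoe with
    | top =>
      rw [truncWeight_top, Finset.sum_eq_zero, pow_zero]
      intro k hk
      have hk0 : (k : ℕ∞) ≠ 0 := by
        have := (Finset.mem_Icc.1 hk).1
        exact_mod_cast (by omega : k ≠ 0)
      rw [if_neg, Multiset.card_zero]
      rw [top_add, ENat.mul_top hk0]
      exact ENat.natCast_ne_top i
    | coe d =>
      have hcast : ∀ k : ℕ, ((i : ℕ∞) = k * ((d : ℕ∞) + 1)) ↔ i = k * (d + 1) := by
        intro k
        exact_mod_cast Iff.rfl
      simp only [hcast, truncWeight_coe, ENat.toNat_natCast]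
      split_ifs with h
      · obtain ⟨m, rfl⟩ := h
        rw [Finset.sum_eq_single m, if_pos (mul_comm _ _), Multiset.card_singleton, pow_one]
        · intro k _ hk
          rw [if_neg, Multiset.card_zero]
          intro h'
          rw [mul_comm] at h'
          exact hk (Nat.eq_of_mul_eq_mul_right d.succ_pos h').symm
        · intro h'
          refine absurd (Finset.mem_Icc.2 ⟨?_, ?_⟩) h'
          · exact Nat.pos_of_mul_pos_left hi.1
          · exact (Nat.le_mul_of_pos_left m d.succ_pos).trans hi.2
      · rw [Finset.sum_eq_zero, pow_zero]
        intro k _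
        rw [if_neg, Multiset.card_zero]
        rintro rfl
        exact h (Dvd.intro_left k rfl)

lemma dCoef_top {n : ℕ} (μ : n.Partition) : dCoef K ⊤ μ = 1 := by
  rw [dCoef_eq_prod]
  exact Multiset.prod_map_one

lemma dCoef_ne_zero [CharZero K] {d : ℕ∞} (hd : 1 ≤ d) {n : ℕ} (μ : n.Partition) :
    dCoef K d μ ≠ 0 := by
  cases d using ENat.recTopCoe with
  | top => rw [dCoef_top]; exact one_ne_zero
  | coe d =>
    have hd' : 1 ≤ d := by exact_mod_cast hd
    refine pow_ne_zero _ (neg_ne_zero.2 (Nat.cast_ne_zero.2 ?_))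
    rw [ENat.toNat_natCast]
    omega

lemma dCoef_one {n : ℕ} (μ : n.Partition) : dCoef K 1 μ = epsSign K μ := by
  have hcard : μ.parts.card ≤ n := by
    conv_rhs => rw [← μ.parts_sum]
    simpa using Multiset.card_nsmul_le_sum fun i hi => Nat.succ_le_of_lt (μ.parts_pos hi)
  have hw : ∀ k, truncWeight K 1 k = (-1) ^ (k + 1) := by
    intro k
    have := truncWeight_coe (K := K) 1 k
    rw [Nat.cast_one] at this
    rw [this, pow_succ]
    rcases Nat.even_or_odd k with h | h
    · simp [h.neg_one_pow, h.two_dvd]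
    · simp [h.neg_one_pow, h.not_two_dvd_nat]
  have hprod : ∀ s : Multiset ℕ, (s.map (truncWeight K 1)).prod = (-1) ^ (s.sum + s.card) := by
    intro s
    induction s using Multiset.induction_on with
    | empty => simp
    | cons k s ih =>
      rw [Multiset.map_cons, Multiset.prod_cons, ih, hw, ← pow_add, Multiset.sum_cons,
        Multiset.card_cons]
      congr 1
      omega
  rw [dCoef_eq_prod, epsSign, hprod, μ.parts_sum]
  obtain ⟨m, hm⟩ := Nat.exists_eq_add_of_le hcard
  rw [show n - μ.parts.card = m by omega, show n + μ.parts.card = m + 2 * μ.parts.card by omega,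
    pow_add, pow_mul]
  simp

/-- In one variable, `exp (∑_k D_k t ^ k / k) = 1 + t + ⋯ + t ^ d`. -/
lemma cycleSum_truncWeight [CharZero K] (d : ℕ∞) (n : ℕ) :
    cycleSum K (truncWeight K d) n = if (n : ℕ∞) ≤ d then 1 else 0 := by
  have hseries : cycleSeries K (truncWeight K d) =
      PowerSeries.mk fun n : ℕ => if (n : ℕ∞) ≤ d then (1 : K) else 0 := by
    refine eq_of_derivative_eq_mul K (derivative_cycleSeries _) ?_ (by simp [cycleSeries])
    ext n
    rw [PowerSeries.coeff_derivative, mul_comm (PowerSeries.mk _), PowerSeries.coeff_mul]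
    simp only [PowerSeries.coeff_mk]
    rw [Finset.Nat.sum_antidiagonal_eq_sum_range_succ
      (fun i j => (if (i : ℕ∞) ≤ d then (1 : K) else 0) * truncWeight K d (j + 1))]
    cases d using ENat.recTopCoe with
    | top => simp [truncWeight_top]
    | coe d =>
      simp only [Nat.cast_le, ite_mul, one_mul, zero_mul]
      split_ifs with h
      · rw [Finset.sum_congr rfl fun j hj => ?_, Finset.sum_const, Finset.card_range, nsmul_one]
        · push_cast
          rfl
        · have := Finset.mem_range.1 hj
          rw [if_pos (by omega), truncWeight_coe, if_neg]
          intro h'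
          have := Nat.le_of_dvd (by omega) h'
          omega
      -- For `n ≥ d` the surviving terms are the weights of `n + 1 - d, …, n + 1`.
      · rw [← Finset.sum_filter, ← sum_range_truncWeight d (n + 1 - d), eq_comm,
          ← Finset.sum_range_reflect]
        refine Finset.sum_congr ?_ fun j hj => ?_
        · ext j
          simp only [Finset.mem_filter, Finset.mem_range]
          omega
        · have := Finset.mem_range.1 hj
          congr 1
          omega
  have hcoeff := congrArg (PowerSeries.coeff n) hseries
  simpa only [cycleSeries, PowerSeries.coeff_mk] using hcoeff

/-! ### Expansion in power sums -/

lemma prod_smul_psf (d : ℕ∞) {n : ℕ} (μ : n.Partition) :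
    (μ.parts.map fun k => truncWeight K d k • psf K k).prod = dCoef K d μ • psfPart K μ := by
  simp only [Algebra.smul_def]
  rw [Multiset.prod_map_mul, dCoef_eq_prod, psfPart, map_multiset_prod, Multiset.map_map]
  rfl

open Classical in
lemma thsf_eq_cycleSum [CharZero K] (d : ℕ∞) (n : ℕ) :
    thsf K d n = cycleSum K (fun k => truncWeight K d k • psf K k) n := by
  ext a
  have hl : coeff a (thsf K d n) = if (∀ i, (a i : ℕ∞) ≤ d) ∧ a.degree = n then 1 else 0 := rfl
  have hr : coeff a (cycleSum K (fun k => truncWeight K d k • psf K k) n) =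
      ∑ μ : n.Partition, ((zNum μ : K)⁻¹ * coeff a (psfPart K μ)) •
        (μ.parts.map (truncWeight K d)).prod := by
    rw [cycleSum, map_sum]
    refine Finset.sum_congr rfl fun μ _ => ?_
    rw [prod_smul_psf, coeff_smul, coeff_smul, dCoef_eq_prod, smul_eq_mul]
    ring
  rw [hl, hr]
  by_cases hn : a.degree = n
  · rw [sum_coeff_psfPart _ hn]
    simp only [cycleSum_truncWeight, hn, and_true]
    split_ifs with h
    · exact (Finset.prod_eq_one fun i _ => if_pos (h i)).symm
    · push Not at h
      obtain ⟨i, hi⟩ := h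
      refine (Finset.prod_eq_zero (i := i) ?_ (if_neg hi.not_ge)).symm
      rw [Finsupp.mem_support_iff]
      intro h0
      rw [h0, Nat.cast_zero] at hi
      exact not_lt_bot hi
  · rw [if_neg fun h => hn h.2]
    refine (Finset.sum_eq_zero fun μ _ => ?_).symm
    rw [coeff_psfPart_eq_zero μ hn, mul_zero, zero_smul]

/-- The expansion of `h_λ^{[d]}` in power sums; the coefficient of `x ^ a` in `p_μ`, for an
exponent `a` with parts `λ`, is the entry `R_{μλ}`. -/
lemma thsfPart_eq_sum [CharZero K] (d : ℕ∞) {n : ℕ} (lam : n.Partition) {a : ℕ →₀ ℕ}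
    (ha : a.support.val.map a = lam.parts) :
    thsfPart K d lam =
      ∑ μ : n.Partition,
        ((zNum μ : K)⁻¹ * dCoef K d μ * coeff a (psfPart K μ)) • psfPart K μ := by
  have hn : a.degree = n := by
    rw [← lam.parts_sum, ← ha]
    rfl
  have h := sum_coeff_psfPart (K := K) (fun k => truncWeight K d k • psf K k) hn
  simp only [← thsf_eq_cycleSum, prod_smul_psf, smul_smul] at h
  rw [thsfPart, ← ha, Multiset.map_map]
  refine Eq.trans h.symm (Finset.sum_congr rfl fun μ _ => ?_)
  rw [mul_right_comm]

end PowerSums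

/-! ### Exponents and their partitions -/

/-- The multiset of the nonzero exponents of the monomial `x ^ a`. -/
def exponentParts (a : ℕ →₀ ℕ) : Multiset ℕ :=
  a.support.val.map a

lemma sum_exponentParts (a : ℕ →₀ ℕ) : (exponentParts a).sum = a.degree := rfl

lemma card_exponentParts (a : ℕ →₀ ℕ) : (exponentParts a).card = a.support.card :=
  Multiset.card_map _ _

lemma exponentParts_single_add {i k : ℕ} (hk : k ≠ 0) {a : ℕ →₀ ℕ} (hi : i ∉ a.support) :
    exponentParts (Finsupp.single i k + a) = k ::ₘ exponentParts a := by
  rw [exponentParts, Finsupp.support_single_add hi hk, Finset.cons_val, Multiset.map_cons]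
  congr 1
  · simpa using hi
  · refine Multiset.map_congr rfl fun j hj => ?_
    have : i ≠ j := fun h => hi (h ▸ hj)
    simp [this]

lemma exists_partition_parts_eq {n : ℕ} {a : ℕ →₀ ℕ} (ha : a.degree = n) :
    ∃ μ : n.Partition, exponentParts a = μ.parts := by
  refine ⟨⟨exponentParts a, fun hi => ?_, ha⟩, rfl⟩
  obtain ⟨j, hj, rfl⟩ := Multiset.mem_map.1 hi
  exact Nat.pos_of_ne_zero (Finsupp.mem_support_iff.1 hj)

lemma exists_exponentParts_eq (s : Multiset ℕ) (hs : ∀ k ∈ s, 0 < k) :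
    ∃ a : ℕ →₀ ℕ, exponentParts a = s := by
  induction s using Multiset.induction_on with
  | empty => exact ⟨0, by simp [exponentParts]⟩
  | cons k s ih =>
    obtain ⟨a, ha⟩ := ih fun i hi => hs i (Multiset.mem_cons_of_mem hi)
    obtain ⟨i, hi⟩ := Infinite.exists_notMem_finset a.support
    exact ⟨Finsupp.single i k + a, by
      rw [exponentParts_single_add (hs k (Multiset.mem_cons_self k s)).ne' hi, ha]⟩

/-- An exponent whose nonzero entries are the parts of `μ`. -/
def partitionExponent {n : ℕ} (μ : n.Partition) : ℕ →₀ ℕ :=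
  (exists_exponentParts_eq μ.parts fun _ h => μ.parts_pos h).choose

lemma exponentParts_partitionExponent {n : ℕ} (μ : n.Partition) :
    exponentParts (partitionExponent μ) = μ.parts :=
  (exists_exponentParts_eq μ.parts fun _ h => μ.parts_pos h).choose_spec

lemma exists_eq_embDomain (e : Equiv.Perm ℕ) (a : ℕ →₀ ℕ) :
    ∃ b, a = Finsupp.embDomain e.toEmbedding b :=
  ⟨Finsupp.embDomain e.symm.toEmbedding a, by
    rw [Finsupp.embDomain_eq_mapDomain, Finsupp.embDomain_eq_mapDomain, ← Finsupp.mapDomain_comp]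
    simp⟩

/-- Two exponents with the same parts differ by a permutation of the variables. -/
lemma exists_embDomain_eq {a b : ℕ →₀ ℕ} (h : exponentParts a = exponentParts b) :
    ∃ e : Equiv.Perm ℕ, Finsupp.embDomain e.toEmbedding a = b := by
  classical
  have hfib : ∀ c : ℕ, Nonempty
      ({i : a.support // a i = c} ≃ {i : b.support // b i = c}) := by
    intro c
    refine Fintype.card_eq.1 ?_
    have hcount : ∀ a : ℕ →₀ ℕ,
        Fintype.card {i : a.support // a i = c} = (exponentParts a).count c := by
      intro a
      rw [exponentParts, Multiset.count_map, Fintype.card_subtype, ← Finset.filter_val,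
        Finset.card_val, ← Finset.card_map (Function.Embedding.subtype _)]
      congr 1
      ext i
      simp [eq_comm, and_comm]
    rw [hcount, hcount, h]
  obtain ⟨e₀, he₀⟩ : ∃ e₀ : a.support ≃ b.support, ∀ i, b (e₀ i) = a i :=
    ⟨Equiv.ofFiberEquiv (f := fun i : a.support => a i) (g := fun i : b.support => b i)
      fun c => (hfib c).some,
      fun i => Equiv.ofFiberEquiv_map (g := fun i : b.support => b i) _ i⟩
  obtain ⟨e, he⟩ := Equiv.Perm.exists_extending_pair (fun i : a.support => (i : ℕ))
    (fun i => (e₀ i : ℕ)) Subtype.val_injective (Subtype.val_injective.comp e₀.injective)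
  refine ⟨e, Finsupp.ext fun j => ?_⟩
  obtain ⟨i, rfl⟩ := e.surjective j
  change Finsupp.embDomain e.toEmbedding a (e.toEmbedding i) = _
  rw [Finsupp.embDomain_apply_self]
  by_cases hi : i ∈ a.support
  · change a i = b (e i)
    rw [he ⟨i, hi⟩, he₀]
  · have hj : e i ∉ b.support := by
      intro hj
      obtain ⟨i', hi'⟩ := e₀.surjective ⟨e i, hj⟩
      have := he i'
      rw [hi'] at this
      exact hi (e.injective this ▸ i'.2)
    rw [Finsupp.notMem_support_iff.1 hi]
    exact (Finsupp.notMem_support_iff.1 hj).symm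

section

variable {K : Type*} [Field K]

/-! ### The monomial symmetric functions -/

open Classical in
lemma coeff_msf {n : ℕ} (μ : n.Partition) (a : ℕ →₀ ℕ) :
    coeff a (msf K μ) = if exponentParts a = μ.parts then 1 else 0 := rfl

lemma coeff_partitionExponent_msf {n : ℕ} (μ ν : n.Partition) :
    coeff (partitionExponent μ) (msf K ν) = if ν = μ then 1 else 0 := by
  rw [coeff_msf, exponentParts_partitionExponent]
  simp only [← Nat.Partition.ext_iff, eq_comm]

lemma coeff_sum_smul_msf {n : ℕ} (c : n.Partition → K) (μ : n.Partition) :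
    coeff (partitionExponent μ) (∑ ν, c ν • msf K ν) = c μ := by
  classical
  simp [coeff_partitionExponent_msf]

lemma linearIndependent_msf (n : ℕ) : LinearIndependent K (msf K : n.Partition → _) := by
  rw [Fintype.linearIndependent_iff]
  intro c hc μ
  rw [← coeff_sum_smul_msf c μ, hc, map_zero]

/-- Symmetric functions have equal coefficients at exponents with the same parts. -/
lemma coeff_eq_of_exponentParts_eq {f : MvPowerSeries ℕ K} (hf : f ∈ Lambda K) {a b : ℕ →₀ ℕ}
    (h : exponentParts a = exponentParts b) : coeff a f = coeff b f := by
  obtain ⟨e, rfl⟩ := exists_embDomain_eq h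
  conv_rhs => rw [← hf.1 e]
  exact (coeff_embDomain_rename e.toEmbedding f a).symm

lemma eq_sum_smul_msf {n : ℕ} {f : MvPowerSeries ℕ K} (hf : f ∈ LambdaDeg K n) :
    f = ∑ μ : n.Partition, coeff (partitionExponent μ) f • msf K μ := by
  classical
  ext a
  rw [map_sum]
  simp only [coeff_smul, coeff_msf]
  by_cases ha : a.degree = n
  · obtain ⟨μ, hμ⟩ := exists_partition_parts_eq ha
    rw [Finset.sum_eq_single μ, if_pos hμ, mul_one]
    · exact coeff_eq_of_exponentParts_eq hf.1 (by rw [hμ, exponentParts_partitionExponent])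
    · intro ν _ hν
      rw [if_neg, mul_zero]
      rw [hμ]
      exact fun h => hν (Nat.Partition.ext h.symm)
    · simp
  · rw [Finset.sum_eq_zero]
    · by_contra h
      exact ha (hf.2 a h)
    · intro μ _
      rw [if_neg, mul_zero]
      intro h
      exact ha (by rw [← sum_exponentParts, h, μ.parts_sum])

/-! ### Linear independence of the power sums -/

lemma rename_psf (e : Equiv.Perm ℕ) (k : ℕ) : rename e (psf K k) = psf K k := by
  classical
  ext a
  obtain ⟨b, rfl⟩ := exists_eq_embDomain e a
  refine (coeff_embDomain_rename e.toEmbedding _ b).trans ?_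
  rw [coeff_psf, coeff_psf]
  congr 1
  refine propext ⟨?_, ?_⟩
  · rintro ⟨i, rfl⟩
    exact ⟨e i, Finsupp.embDomain_single _ _ _⟩
  · rintro ⟨i, hi⟩
    refine ⟨e.symm i, Finsupp.embDomain_injective e.toEmbedding (hi.trans ?_)⟩
    rw [Finsupp.embDomain_single]
    simp

lemma psfPart_mem_LambdaDeg {n : ℕ} (μ : n.Partition) : psfPart K μ ∈ LambdaDeg K n := by
  have hdeg : ∀ a, coeff a (psfPart K μ) ≠ 0 → a.degree = n := fun a ha => by
    by_contra h
    exact ha (coeff_psfPart_eq_zero μ h)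
  refine ⟨⟨fun e => ?_, n, fun a ha => (hdeg a ha).le⟩, hdeg⟩
  rw [psfPart, map_multiset_prod, Multiset.map_map]
  congr 1
  exact Multiset.map_congr rfl fun k _ => rename_psf e k

/-- If `x ^ a` occurs in a product of power sums, then its exponents are sums of disjoint groups of
the indices; so there are at most as many of them, with equality only if they are the indices. -/
lemma card_support_le_of_coeff_prod_psf_ne_zero (s : Multiset ℕ) (hs : ∀ k ∈ s, 0 < k)
    {a : ℕ →₀ ℕ} (ha : coeff a (s.map (psf K)).prod ≠ 0) :
    a.support.card ≤ s.card ∧ (a.support.card = s.card → exponentParts a = s) := by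
  classical
  induction s using Multiset.induction_on generalizing a with
  | empty =>
    rw [Multiset.map_zero, Multiset.prod_zero, coeff_one] at ha
    obtain rfl : a = 0 := by
      by_contra h
      exact ha (if_neg h)
    simp [exponentParts]
  | cons k s ih =>
    rw [Multiset.map_cons, Multiset.prod_cons, coeff_mul] at ha
    obtain ⟨⟨b, c⟩, hbc, hne⟩ := Finset.exists_ne_zero_of_sum_ne_zero ha
    have hbc' : b + c = a := Finset.HasAntidiagonal.mem_antidiagonal.1 hbc
    obtain ⟨i, rfl⟩ : ∃ i, b = Finsupp.single i k := by
      by_contra h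
      exact left_ne_zero_of_mul hne (if_neg h)
    have hk := (hs k (Multiset.mem_cons_self k s)).ne'
    obtain ⟨h1, h2⟩ := ih (fun j hj => hs j (Multiset.mem_cons_of_mem hj))
      (right_ne_zero_of_mul hne)
    dsimp only at h1 h2
    rw [Multiset.card_cons, ← hbc']
    by_cases hi : i ∈ c.support
    · have hsub : (Finsupp.single i k + c).support ⊆ c.support := by
        refine Finsupp.support_add.trans (Finset.union_subset ?_ subset_rfl)
        exact Finsupp.support_single_subset.trans (Finset.singleton_subset_iff.2 hi)
      have := Finset.card_le_card hsub
      exact ⟨by omega, fun h => by omega⟩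
    · rw [exponentParts_single_add hk hi, Finsupp.support_single_add hi hk, Finset.card_cons]
      exact ⟨by omega, fun h => by rw [h2 (by omega)]⟩

lemma exists_coeff_prod_psf_eq_natCast (s : Multiset ℕ) (a : ℕ →₀ ℕ) :
    ∃ m : ℕ, coeff a (s.map (psf K)).prod = m := by
  classical
  induction s using Multiset.induction_on generalizing a with
  | empty =>
    rw [Multiset.map_zero, Multiset.prod_zero, coeff_one]
    exact ⟨if a = 0 then 1 else 0, by push_cast; rfl⟩
  | cons k s ih =>
    choose m hm using ih
    rw [Multiset.map_cons, Multiset.prod_cons, coeff_mul]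
    refine ⟨∑ p ∈ Finset.HasAntidiagonal.antidiagonal a,
      (if ∃ i, p.1 = Finsupp.single i k then 1 else 0) * m p.2, ?_⟩
    push_cast
    refine Finset.sum_congr rfl fun p _ => ?_
    rw [hm, coeff_psf]

/-- The monomial `x^λ` occurs in `p_λ`. -/
lemma coeff_prod_psf_ne_zero [CharZero K] (s : Multiset ℕ) (hs : ∀ k ∈ s, 0 < k) {a : ℕ →₀ ℕ}
    (ha : exponentParts a = s) : coeff a (s.map (psf K)).prod ≠ 0 := by
  classical
  induction s using Multiset.induction_on generalizing a with
  | empty =>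
    have h0 : a = 0 := by
      rw [exponentParts, Multiset.map_eq_zero, Finset.val_eq_zero] at ha
      exact Finsupp.support_eq_empty.1 ha
    simp [h0]
  | cons k s ih =>
    obtain ⟨i, hi, hik⟩ := Multiset.mem_map.1 (ha ▸ Multiset.mem_cons_self k s)
    have hk := (hs k (Multiset.mem_cons_self k s)).ne'
    have hac : Finsupp.single i k + a.erase i = a := by
      rw [← hik, Finsupp.single_add_erase]
    have hi' : i ∉ (a.erase i).support := by simp
    have hc : exponentParts (a.erase i) = s := by
      rw [← hac, exponentParts_single_add hk hi'] at ha
      exact (Multiset.cons_inj_right k).1 ha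
    have hne := ih (fun j hj => hs j (Multiset.mem_cons_of_mem hj)) hc
    choose m hm using exists_coeff_prod_psf_eq_natCast (K := K) s
    have hterm : ∀ p : (ℕ →₀ ℕ) × (ℕ →₀ ℕ), coeff p.1 (psf K k) * coeff p.2 (s.map (psf K)).prod =
        (((if ∃ i, p.1 = Finsupp.single i k then 1 else 0) * m p.2 : ℕ) : K) := by
      intro p
      push_cast
      rw [hm, coeff_psf]
    rw [Multiset.map_cons, Multiset.prod_cons, coeff_mul, Finset.sum_congr rfl fun p _ => hterm p,
      ← Nat.cast_sum, Nat.cast_ne_zero]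
    rw [hm, Nat.cast_ne_zero] at hne
    -- All terms are natural numbers, so it suffices that one of them is nonzero.
    intro h
    rw [Finset.sum_eq_zero_iff] at h
    have := h (Finsupp.single i k, a.erase i) (Finset.HasAntidiagonal.mem_antidiagonal.2 hac)
    rw [if_pos ⟨i, rfl⟩, one_mul] at this
    exact hne this

/-- The power sums expand triangularly in the `m_λ` with respect to the number of parts. -/
lemma linearIndependent_psfPart [CharZero K] (n : ℕ) :
    LinearIndependent K (psfPart K : n.Partition → _) := by
  classical
  rw [Fintype.linearIndependent_iff]
  intro c hc
  by_contra! hne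
  -- For `λ` of maximal length with `c λ ≠ 0`, only `p_λ` contributes the monomial `x^λ`.
  obtain ⟨lam, hlam, hmax⟩ := Finset.exists_max_image
    (Finset.univ.filter fun μ : n.Partition => c μ ≠ 0) (fun μ => μ.parts.card)
    (by simpa [Finset.filter_nonempty_iff] using hne)
  rw [Finset.mem_filter] at hlam
  have hcoeff := congrArg (coeff (partitionExponent lam)) hc
  rw [map_sum, map_zero, Finset.sum_eq_single lam] at hcoeff
  · rw [coeff_smul] at hcoeff
    exact mul_ne_zero hlam.2 (coeff_prod_psf_ne_zero _ (fun _ h => lam.parts_pos h)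
      (exponentParts_partitionExponent lam)) hcoeff
  · intro μ _ hμ
    rw [coeff_smul]
    by_contra h
    obtain ⟨h1, h2⟩ := card_support_le_of_coeff_prod_psf_ne_zero _ (fun _ h => μ.parts_pos h)
      (right_ne_zero_of_mul h)
    rw [← card_exponentParts, exponentParts_partitionExponent] at h1 h2
    have h3 := hmax μ (by simpa using left_ne_zero_of_mul h)
    exact hμ (Nat.Partition.ext (h2 (le_antisymm h1 h3)).symm)
  · simp

/-! ### Transition matrices and bases -/

section LinearAlgebra

variable {ι V : Type*} [Fintype ι] [AddCommGroup V] [Module K V] {u v : ι → V}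
  {W : Submodule K V} {A : Matrix ι ι K}

/-- A linearly independent family in `W` spans `W` if a family of the same size does. -/
lemma isBasisOf_of_le_span (hu : LinearIndependent K u) (huW : ∀ i, u i ∈ W)
    (hW : W ≤ Submodule.span K (Set.range v)) : IsBasisOf u W := by
  refine ⟨hu, ?_⟩
  have : FiniteDimensional K (Submodule.span K (Set.range v)) :=
    FiniteDimensional.span_of_finite K (Set.finite_range v)
  have : FiniteDimensional K W := Submodule.finiteDimensional_of_le hW
  refine Submodule.eq_of_le_of_finrank_le (Submodule.span_le.2 (Set.range_subset_iff.2 huW)) ?_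
  rw [finrank_span_eq_card hu]
  exact (Submodule.finrank_mono hW).trans (finrank_range_le_card v)

lemma IsTransitionMatrix.sum_smul_eq (hA : IsTransitionMatrix u v A) (c : ι → K) :
    ∑ i, c i • u i = ∑ j, (c ᵥ* A) j • v j := by
  simp only [hA _, Finset.smul_sum, smul_smul]
  rw [Finset.sum_comm]
  simp only [← Finset.sum_smul]
  rfl

lemma IsTransitionMatrix.eq {A' : Matrix ι ι K} (hv : LinearIndependent K v)
    (hA : IsTransitionMatrix u v A) (hA' : IsTransitionMatrix u v A') : A = A' := by
  ext i j
  refine sub_eq_zero.1 (Fintype.linearIndependent_iff.1 hv (fun j => A i j - A' i j) ?_ j)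
  simp only [sub_smul, Finset.sum_sub_distrib]
  rw [← hA, ← hA', sub_self]

variable [DecidableEq ι]

lemma IsTransitionMatrix.isUnit (hu : LinearIndependent K u) (hA : IsTransitionMatrix u v A) :
    IsUnit A := by
  rw [← Matrix.linearIndependent_rows_iff_isUnit, Fintype.linearIndependent_iff]
  intro c hc
  refine Fintype.linearIndependent_iff.1 hu c ?_
  have h0 : c ᵥ* A = 0 := by
    rw [Matrix.vecMul_eq_sum]
    exact hc
  simp [hA.sum_smul_eq, h0]

lemma IsTransitionMatrix.linearIndependent (hv : LinearIndependent K v)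
    (hA : IsTransitionMatrix u v A) (h : IsUnit A) : LinearIndependent K u := by
  rw [Fintype.linearIndependent_iff]
  intro c hc
  rw [hA.sum_smul_eq] at hc
  have h0 : c ᵥ* A = 0 ᵥ* A := by
    rw [Matrix.zero_vecMul]
    exact funext (Fintype.linearIndependent_iff.1 hv _ hc)
  exact congrFun (Matrix.vecMul_injective_of_isUnit h h0)

end LinearAlgebra

/-- Bases of all the homogeneous parts of `Λ` together form a basis of `Λ`. -/
lemma isBasisOf_Lambda {ι : ℕ → Type*} {u : ∀ n, ι n → MvPowerSeries ℕ K}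
    (hu : ∀ n, IsBasisOf (u n) (LambdaDeg K n)) :
    IsBasisOf (fun x : Σ n, ι n => u x.1 x.2) (Subalgebra.toSubmodule (Lambda K)) := by
  constructor
  · refine linearIndependent_iUnion_finite (fun n => (hu n).1) fun n t _ hn => ?_
    have hker : ⨆ i ∈ t, Submodule.span K (Set.range (u i)) ≤
        LinearMap.ker (homogeneousComponent (σ := ℕ) (R := K) n) := by
      refine iSup₂_le fun i hi f hf => ?_
      rw [(hu i).2] at hf
      rw [LinearMap.mem_ker]
      ext a
      rw [coeff_homogeneousComponent, map_zero]
      split_ifs with ha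
      · by_contra h
        exact hn ((ha.symm.trans (hf.2 a h)) ▸ hi)
      · rfl
    refine Disjoint.mono_right hker ?_
    rw [(hu n).2, Submodule.disjoint_def]
    intro f hf hf0
    ext a
    by_contra h
    have := congrArg (coeff a) (LinearMap.mem_ker.1 hf0)
    rw [coeff_homogeneousComponent, if_pos (hf.2 a h)] at this
    exact h this
  · have hspan : Submodule.span K (Set.range fun x : Σ n, ι n => u x.1 x.2) =
        ⨆ n, LambdaDeg K n := by
      rw [Set.range_sigma_eq_iUnion_range, Submodule.span_iUnion]
      exact iSup_congr fun n => (hu n).2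
    rw [hspan]
    refine le_antisymm (iSup_le fun n f hf => hf.1) fun f hf => ?_
    obtain ⟨hsymm, N, hN⟩ := hf
    have hsum : f = ∑ n ∈ Finset.range (N + 1), homogeneousComponent n f := by
      ext a
      rw [map_sum]
      simp only [coeff_homogeneousComponent, Finset.sum_ite_eq, Finset.mem_range]
      split_ifs with ha
      · rfl
      · by_contra h
        exact ha (Nat.lt_succ_of_le (hN a h))
    rw [hsum]
    refine Submodule.sum_mem _ fun n _ => Submodule.mem_iSup_of_mem n ?_
    have hdeg : ∀ a, coeff a (homogeneousComponent n f) ≠ 0 → a.degree = n := by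
      intro a ha
      rw [coeff_homogeneousComponent] at ha
      by_contra h
      exact ha (if_neg h)
    refine ⟨⟨fun e => ?_, n, fun a ha => (hdeg a ha).le⟩, hdeg⟩
    ext a
    obtain ⟨b, rfl⟩ := exists_eq_embDomain e a
    refine (coeff_embDomain_rename e.toEmbedding _ b).trans ?_
    have hb : (Finsupp.embDomain e.toEmbedding b).degree = b.degree := by
      rw [Finsupp.degree_apply, Finsupp.degree_apply, Finsupp.support_embDomain, Finset.sum_map]
      simp only [Finsupp.embDomain_apply_self]
    rw [coeff_homogeneousComponent, coeff_homogeneousComponent, hb]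
    congr 1
    conv_rhs => rw [← hsymm e]
    exact (coeff_embDomain_rename e.toEmbedding f b).symm

/-- The power sums expand into monomial functions by the matrix of the coefficients of `x^λ` in
`p_μ`. -/
lemma isTransitionMatrix_psfPart_msf (n : ℕ) :
    IsTransitionMatrix (psfPart K : n.Partition → _) (msf K)
      (fun μ lam => coeff (partitionExponent lam) (psfPart K μ)) :=
  fun μ => eq_sum_smul_msf (psfPart_mem_LambdaDeg μ)

lemma IsTransitionMatrix.apply_eq_coeff {n : ℕ} {R : Matrix n.Partition n.Partition K}
    (hR : IsTransitionMatrix (psfPart K) (msf K) R) (μ lam : n.Partition) :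
    R μ lam = coeff (partitionExponent lam) (psfPart K μ) := by
  rw [hR μ, coeff_sum_smul_msf]

section

variable [CharZero K]

lemma isBasisOf_psfPart (n : ℕ) : IsBasisOf (psfPart K : n.Partition → _) (LambdaDeg K n) :=
  isBasisOf_of_le_span (v := msf K) (linearIndependent_psfPart n) psfPart_mem_LambdaDeg
    fun f hf => by
      rw [eq_sum_smul_msf hf]
      exact Submodule.sum_mem _ fun μ _ => Submodule.smul_mem _ _ (Submodule.subset_span ⟨μ, rfl⟩)

lemma IsTransitionMatrix.thsfPart_eq (d : ℕ∞) {n : ℕ} {R : Matrix n.Partition n.Partition K}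
    (hR : IsTransitionMatrix (psfPart K) (msf K) R) (lam : n.Partition) :
    thsfPart K d lam =
      ∑ μ : n.Partition, ((zNum μ : K)⁻¹ * dCoef K d μ * R μ lam) • psfPart K μ := by
  rw [thsfPart_eq_sum d lam (exponentParts_partitionExponent lam)]
  simp only [hR.apply_eq_coeff]

lemma IsTransitionMatrix.thsfPart_psfPart (d : ℕ∞) {n : ℕ} {R : Matrix n.Partition n.Partition K}
    (hR : IsTransitionMatrix (psfPart K) (msf K) R) :
    IsTransitionMatrix (thsfPart K d) (psfPart K)
      (Rᵀ * Matrix.diagonal (fun μ => (zNum μ : K)⁻¹) * Matrix.diagonal (dCoef K d)) := by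
  intro lam
  rw [hR.thsfPart_eq d lam]
  refine Finset.sum_congr rfl fun μ _ => congrArg (· • psfPart K μ) ?_
  rw [Matrix.mul_diagonal, Matrix.mul_diagonal, Matrix.transpose_apply]
  ring

lemma isBasisOf_thsfPart {d : ℕ∞} (hd : 1 ≤ d) (n : ℕ) :
    IsBasisOf (fun lam : n.Partition => thsfPart K d lam) (LambdaDeg K n) := by
  classical
  have hR := isTransitionMatrix_psfPart_msf (K := K) n
  have hA := hR.thsfPart_psfPart d
  have hp := isBasisOf_psfPart (K := K) n
  have hdiag : ∀ w : n.Partition → K, (∀ μ, w μ ≠ 0) → IsUnit (Matrix.diagonal w) := fun w hw => by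
    rw [Matrix.isUnit_diagonal, Pi.isUnit_iff]
    exact fun μ => (hw μ).isUnit
  have hunit := (((Matrix.isUnit_transpose _).2 (hR.isUnit hp.1)).mul (hdiag _ fun μ =>
    inv_ne_zero (Nat.cast_ne_zero.2 (zNum_ne_zero μ)))).mul (hdiag _ (dCoef_ne_zero (K := K) hd))
  refine isBasisOf_of_le_span (hA.linearIndependent hp.1 hunit) (fun lam => ?_) hp.2.ge
  rw [hA lam]
  exact Submodule.sum_mem _ fun μ _ => Submodule.smul_mem _ _ (psfPart_mem_LambdaDeg μ)

end

end

end

end SymmFun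

theorem mainTheorem1 {K : Type*} [Field K] [CharZero K] (d : ℕ∞) (hd : 1 ≤ d) :
    (∀ n : ℕ, ∃! R : Matrix n.Partition n.Partition K,
      IsTransitionMatrix (psfPart K) (msf K) R) ∧
    (∀ (n : ℕ) (R : Matrix n.Partition n.Partition K),
      IsTransitionMatrix (psfPart K) (msf K) R →
        (∀ lam : n.Partition, thsfPart K d lam =
          ∑ μ : n.Partition, ((zNum μ : K)⁻¹ * dCoef K d μ * R μ lam) • psfPart K μ) ∧
        (∀ A : Matrix n.Partition n.Partition K,
          IsTransitionMatrix (thsfPart K d) (psfPart K) A ↔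
            A = Rᵀ * Matrix.diagonal (fun μ => (zNum μ : K)⁻¹) * Matrix.diagonal (dCoef K d))) ∧
    (∀ (n : ℕ) (μ : n.Partition), dCoef K 1 μ = epsSign K μ) ∧
    (∀ (n : ℕ) (μ : n.Partition), dCoef K ⊤ μ = 1) ∧
    (∀ n : ℕ, IsBasisOf (fun lam : n.Partition => thsfPart K d lam) (LambdaDeg K n)) ∧
    IsBasisOf (fun lam : (Σ n : ℕ, n.Partition) => thsfPart K d lam.2)
      (Subalgebra.toSubmodule (Lambda K)) := by
  refine ⟨fun n => ⟨_, isTransitionMatrix_psfPart_msf n, fun R hR =>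
    hR.eq (linearIndependent_msf n) (isTransitionMatrix_psfPart_msf n)⟩, fun n R hR =>
    ⟨fun lam => ?_, fun A => ⟨fun hA => ?_, ?_⟩⟩, fun n => dCoef_one, fun n => dCoef_top,
    isBasisOf_thsfPart hd, isBasisOf_Lambda (isBasisOf_thsfPart hd)⟩
  · exact hR.thsfPart_eq d lam
  · exact hA.eq (linearIndependent_psfPart n) (hR.thsfPart_psfPart d)
  · rintro rfl
    exact hR.thsfPart_psfPart d
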